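/- For $m\ge 1$ let $P_m\subset\mathbb{R}^m$ be the permutohedron, i.e. the convex hull of the points $(\sigma^{-1}(1),\dots,\sigma^{-1}(m))$, $\sigma\in S_m$, and for $k\ge 0$ let $\Delta^k$ be the standard $k$-simplex with vertices $v_1,\dots,v_{k+1}$; write $\partial_i\Delta^k=v_1\cdots\widehat{v_i}\cdots v_{k+1}$ for the facet spanned by all the vertices except $v_i$. Let $n\ge 3$, $k\ge 2$ and $m_1,\dots,m_k\ge 1$ be integers with $m_1+\cdots+m_k=n-1$, and put $$X=P_{m_1}\times\cdots\times P_{m_k}\times\Delta^k,\qquad Y=P_{m_1}\times\cdots\times P_{m_k}\times\bigcup_{i=2}^{k}\partial_i\Delta^k .$$ Let $\partial X$ be the boundary of the polytope $X$ (relative to its affine span), and let $\operatorname{Int}(Y)$ be the interior of $Y$ as a subspace of $\partial X$. Then $A=\partial X\setminus\operatorname{Int}(Y)$ is a (strong) deformation retract of $X$: there is a continuous map $H\colon X\times[0,1]\to X$ such that $H(x,0)=x$ and $H(x,1)\in A$ for all $x\in X$, and $H(a,t)=a$ for all $a\in A$ and $t\in[0,1]$. -/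

import Mathlib

/-- The vertex `v_σ = (σ⁻¹(1), …, σ⁻¹(n))` of the permutohedron (values shifted from
`{0, …, n-1}` to `{1, …, n}`). -/
def permVertex (n : ℕ) (σ : Equiv.Perm (Fin n)) : Fin n → ℝ :=
  fun i => ((σ⁻¹ i : Fin n) : ℕ) + 1

/-- The permutohedron `P_n ⊆ ℝⁿ`. -/
def permutohedron (n : ℕ) : Set (Fin n → ℝ) :=
  convexHull ℝ (Set.range (permVertex n))

/-- The facet `v_1 ⋯ v̂_i ⋯ v_{k+1}` of the standard simplex `Δ^k = v_1 ⋯ v_{k+1}`: the convex hull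
of all the vertices other than the `i`-th one. Vertices are indexed from `0`. -/
def simplexFacet (k : ℕ) (i : Fin (k + 1)) : Set (Fin (k + 1) → ℝ) :=
  convexHull ℝ ((fun j : Fin (k + 1) => (Pi.single j 1 : Fin (k + 1) → ℝ)) '' {j | j ≠ i})

/-- The union of the facets of `Δ^k` opposite to all the vertices except the first and the last. -/
def innerFacets (k : ℕ) : Set (Fin (k + 1) → ℝ) :=
  ⋃ (i : Fin (k + 1)) (_ : i ≠ 0 ∧ i ≠ Fin.last k), simplexFacet k i

/-- The ambient space `ℝ^{m_1} × ⋯ × ℝ^{m_k} × ℝ^{k+1}`. -/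
abbrev CellAmbient {k : ℕ} (m : Fin k → ℕ) : Type :=
  ((l : Fin k) → Fin (m l) → ℝ) × (Fin (k + 1) → ℝ)

/-- The cell `P_{m_1} × ⋯ × P_{m_k} × Δ^k`. -/
def productCell {k : ℕ} (m : Fin k → ℕ) : Set (CellAmbient m) :=
  (Set.univ.pi fun l => permutohedron (m l)) ×ˢ stdSimplex ℝ (Fin (k + 1))

/-- The part `P_{m_1} × ⋯ × P_{m_k} × ⋃_{i=2}^k v_1 ⋯ v̂_i ⋯ v_{k+1}` of the boundary of the cell. -/
def gluedPart {k : ℕ} (m : Fin k → ℕ) : Set (CellAmbient m) :=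
  (Set.univ.pi fun l => permutohedron (m l)) ×ˢ innerFacets k

/-- The boundary of a convex polytope, taken in its affine span. -/
def polytopeBoundary {k : ℕ} {m : Fin k → ℕ} (X : Set (CellAmbient m)) : Set (CellAmbient m) :=
  intrinsicFrontier ℝ X

/-- The interior of `Y ∩ B` in the subspace `B`, as a subset of the ambient space. -/
def interiorIn {E : Type*} [TopologicalSpace E] (B Y : Set E) : Set E :=
  Subtype.val '' interior (Subtype.val ⁻¹' Y : Set B)

/-- `A` is a (strong) deformation retract of `X`: there is a homotopy of `X`, starting at the
identity, fixing every point of `A` at all times, and ending in a map of `X` into `A`. -/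
def IsDeformationRetract {E : Type*} [TopologicalSpace E] (A X : Set E) : Prop :=
  A ⊆ X ∧ ∃ H : C(X × unitInterval, X),
    (∀ x, H (x, 0) = x) ∧ (∀ x, (H (x, 1) : E) ∈ A) ∧
      ∀ (x : X) (t : unitInterval), (x : E) ∈ A → H (x, t) = x

open Set Topology

/-! Write `X = P × Δ^k` with `P` the product of permutohedra; only convexity, closedness and
nonemptiness of `P` matter. Project radially from `c = (p, e_0 + e_k - e_1)`, with `p` in the
relative interior of `P`. This `c` lies outside `X`, beyond the facets making up `Y`: its inner
coordinates are nonpositive, so pushing a point of `X` away from `c` never crosses an inner facet.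
The ray leaves `X` where `exitLevel`, the maximum of the gauge of `P` and of `1 - x_0`, `1 - x_k`,
reaches `1`. The set `A` is exactly this level set (`frontier_diff_interiorIn_eq`), and the
straight-line homotopy to `exitPoint` is the retraction. -/

/-- `g` is a continuous gauge of `P` centred at `p`, measuring `P` within its affine span. -/
structure IsGaugeAt {V : Type*} [NormedAddCommGroup V] [NormedSpace ℝ V]
    (P : Set V) (p : V) (g : V → ℝ) : Prop where
  mem : p ∈ P
  continuous : Continuous g
  nonneg : ∀ v, 0 ≤ g v
  smul : ∀ r : ℝ, 0 ≤ r → ∀ v, g (r • v) = r * g v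
  le_one_iff : ∀ v ∈ (affineSpan ℝ P).direction, p + v ∈ P ↔ g v ≤ 1

/-- With `p` in the intrinsic interior, `P - p` is a neighbourhood of `0` in the direction space, so
its gauge there is continuous; a linear projection extends it to `V`. -/
theorem exists_isGaugeAt {V : Type*} [NormedAddCommGroup V] [NormedSpace ℝ V]
    [FiniteDimensional ℝ V] {P : Set V} (hP : Convex ℝ P) (hcl : IsClosed P) (hne : P.Nonempty) :
    ∃ p g, IsGaugeAt P p g := by
  obtain ⟨p, hp⟩ := hne.intrinsicInterior hP
  have hpP := intrinsicInterior_subset hp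
  set W := (affineSpan ℝ P).direction
  obtain ⟨π, hπ⟩ := W.subtype.exists_leftInverse_of_injective (Submodule.ker_subtype W)
  have hπ' : ∀ w : W, π (w : V) = w := fun w => LinearMap.congr_fun hπ w
  let K : Set W := {w | p + (w : V) ∈ P}
  have hKc : Convex ℝ K := by
    intro a ha b hb s t hs ht hst
    have := hP ha hb hs ht hst
    simp only [K, mem_ofPred_eq, Submodule.coe_add, Submodule.coe_smul]
    convert this using 1
    rw [smul_add, smul_add, ← one_smul ℝ p, ← hst]
    simp only [smul_smul, hst, mul_one]
    rw [← hst, add_smul]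
    abel
  have hKcl : IsClosed K := hcl.preimage (by fun_prop)
  have hK0 : K ∈ 𝓝 (0 : W) := by
    obtain ⟨q, hq, rfl⟩ := mem_intrinsicInterior.1 hp
    let f : W → affineSpan ℝ P := fun w => ⟨(q : V) + w, by
      rw [add_comm]; exact AffineSubspace.vadd_mem_of_mem_direction w.2 q.2⟩
    have hf : Continuous f := by fun_prop
    have hf0 : f 0 = q := by ext; simp [f]
    have : f ⁻¹' ((↑) ⁻¹' P) ∈ 𝓝 (0 : W) := by
      apply hf.continuousAt.preimage_mem_nhds
      rw [hf0]
      exact mem_interior_iff_mem_nhds.1 hq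
    exact this
  refine ⟨p, fun v => gauge K (π v), hpP,
    (continuous_gauge hKc hK0).comp π.continuous_of_finiteDimensional,
    fun v => gauge_nonneg _, fun r hr v => ?_, fun v hv => ?_⟩
  · simp only [map_smul]
    rw [gauge_smul_of_nonneg hr, smul_eq_mul]
  · have h := gauge_le_one_iff_mem_closure hKc hK0 (x := (⟨v, hv⟩ : W))
    rw [hKcl.closure_eq] at h
    rw [show π v = ⟨v, hv⟩ from hπ' ⟨v, hv⟩, h]
    rfl

/-! ### Facets of the simplex and basic facts on permutohedra. -/

theorem simplexFacet_eq (k : ℕ) (i : Fin (k + 1)) :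
    simplexFacet k i = {s | s ∈ stdSimplex ℝ (Fin (k + 1)) ∧ s i = 0} := by
  apply Subset.antisymm
  · apply convexHull_min
    · rintro _ ⟨j, hj, rfl⟩
      refine ⟨single_mem_stdSimplex ℝ j, ?_⟩
      simp [Pi.single_eq_of_ne (Ne.symm hj)]
    · rintro x ⟨hx, hxi⟩ y ⟨hy, hyi⟩ a b ha hb hab
      exact ⟨convex_stdSimplex ℝ _ hx hy ha hb hab, by simp [hxi, hyi]⟩
  · rintro s ⟨hs, hsi⟩
    have h : s = ∑ j ∈ Finset.univ.erase i, s j • (Pi.single j 1 : Fin (k + 1) → ℝ) := by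
      rw [Finset.sum_erase _ (by simp [hsi])]
      exact pi_eq_sum_univ' s
    rw [h]
    refine (convex_convexHull ℝ _).sum_mem (fun j _ => hs.1 j) ?_ fun j hj => ?_
    · rw [Finset.sum_erase _ hsi]; exact hs.2
    · exact subset_convexHull ℝ _ ⟨j, (Finset.mem_erase.1 hj).1, rfl⟩

theorem mem_innerFacets {k : ℕ} {s : Fin (k + 1) → ℝ} :
    s ∈ innerFacets k ↔
      s ∈ stdSimplex ℝ (Fin (k + 1)) ∧ ∃ i, (i ≠ 0 ∧ i ≠ Fin.last k) ∧ s i = 0 := by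
  simp only [innerFacets, simplexFacet_eq, mem_iUnion, mem_ofPred_eq]
  tauto

theorem isCompact_permutohedron (n : ℕ) : IsCompact (permutohedron n) :=
  (Set.finite_range _).isCompact_convexHull ℝ

theorem permutohedron_nonempty (n : ℕ) : (permutohedron n).Nonempty :=
  (range_nonempty _).convexHull

/-- A point of the intrinsic interior can be moved slightly away from any point of the set. -/
theorem exists_pos_add_smul_sub_mem {V : Type*} [NormedAddCommGroup V] [NormedSpace ℝ V]
    {X : Set V} {x y : V} (hx : x ∈ intrinsicInterior ℝ X) (hy : y ∈ X) :
    ∃ δ : ℝ, 0 < δ ∧ x + δ • (x - y) ∈ X := by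
  obtain ⟨q, hq, rfl⟩ := mem_intrinsicInterior.1 hx
  let f : ℝ → affineSpan ℝ X := fun δ => ⟨(q : V) + δ • ((q : V) - y), by
    rw [add_comm]
    exact AffineSubspace.vadd_mem_of_mem_direction (Submodule.smul_mem _ _
      (AffineSubspace.vsub_mem_direction q.2 (subset_affineSpan ℝ X hy))) q.2⟩
  have hf : Continuous f := by fun_prop
  have hf0 : f 0 = q := by ext; simp [f]
  have h : f ⁻¹' ((↑) ⁻¹' X) ∈ 𝓝 (0 : ℝ) := by
    apply hf.continuousAt.preimage_mem_nhds
    rw [hf0]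
    exact mem_interior_iff_mem_nhds.1 hq
  obtain ⟨ε, hε, hb⟩ := Metric.mem_nhds_iff.1 h
  refine ⟨ε / 2, by positivity, hb ?_⟩
  simp [abs_of_pos hε, hε]

/-- A point all of whose neighbours in a larger affine subspace lie in the set is not on the
intrinsic frontier. -/
theorem notMem_intrinsicFrontier_of_isOpen {V : Type*} [NormedAddCommGroup V] [NormedSpace ℝ V]
    {X U : Set V} {x : V} (S : AffineSubspace ℝ V) (hXS : X ⊆ S) (hU : IsOpen U) (hxU : x ∈ U)
    (hUX : U ∩ S ⊆ X) : x ∉ intrinsicFrontier ℝ X := by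
  rintro ⟨q, hq, rfl⟩
  refine hq.2 (mem_interior.2 ⟨Subtype.val ⁻¹' U, fun y hy => ?_, hU.preimage continuous_subtype_val, hxU⟩)
  exact hUX ⟨hy, affineSpan_le.2 hXS y.2⟩

/-! ### The exit level and the description of `A` as its level set `1`. -/

section ExitLevel

variable {V : Type*} [NormedAddCommGroup V] {p : V} {g : V → ℝ} {k : ℕ}

/-- The inverse of the factor by which `x` has to be pushed away from the point
`(p, e_0 + e_k - e_1)` to leave `P × Δ^k`. -/
def exitLevel (p : V) (g : V → ℝ) (x : V × (Fin (k + 1) → ℝ)) : ℝ :=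
  max (g (x.1 - p)) (max (1 - x.2 0) (1 - x.2 (Fin.last k)))

/-- Otherwise `x_0` and `x_k` would both be at least `1`, while their sum is at most `1`. -/
theorem exitLevel_pos (hk : k ≠ 0) {x : V × (Fin (k + 1) → ℝ)}
    (hx : x.2 ∈ stdSimplex ℝ (Fin (k + 1))) : 0 < exitLevel p g x := by
  have hne : (0 : Fin (k + 1)) ≠ Fin.last k := by
    simpa [Fin.ext_iff] using hk.symm
  have hsum : x.2 0 + x.2 (Fin.last k) ≤ 1 := by
    rw [← hx.2, ← Finset.sum_pair hne]
    exact Finset.sum_le_sum_of_subset_of_nonneg (Finset.subset_univ _) fun i _ _ => hx.1 i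
  rw [exitLevel, lt_max_iff, lt_max_iff]
  by_contra! hcon
  linarith [hcon.2.1, hcon.2.2]

theorem eq_of_exitLevel_eq_one {x : V × (Fin (k + 1) → ℝ)} (hu : exitLevel p g x = 1) :
    g (x.1 - p) = 1 ∨ x.2 0 = 0 ∨ x.2 (Fin.last k) = 0 := by
  rw [exitLevel] at hu
  rcases max_choice (g (x.1 - p)) (max (1 - x.2 0) (1 - x.2 (Fin.last k))) with h1 | h1
  · left; rw [← h1, hu]
  · rcases max_choice (1 - x.2 0) (1 - x.2 (Fin.last k)) with h2 | h2
    · right; left; linarith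
    · right; right; linarith

variable [NormedSpace ℝ V] {P : Set V}

theorem IsGaugeAt.sub_mem_direction (h : IsGaugeAt P p g) {q : V} (hq : q ∈ affineSpan ℝ P) :
    q - p ∈ (affineSpan ℝ P).direction :=
  AffineSubspace.vsub_mem_direction hq (subset_affineSpan ℝ P h.mem)

theorem IsGaugeAt.mem_iff (h : IsGaugeAt P p g) {q : V} (hq : q ∈ affineSpan ℝ P) :
    q ∈ P ↔ g (q - p) ≤ 1 := by
  rw [← h.le_one_iff _ (h.sub_mem_direction hq), add_sub_cancel]

theorem continuous_exitLevel (h : IsGaugeAt P p g) :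
    Continuous (exitLevel p g : V × (Fin (k + 1) → ℝ) → ℝ) := by
  have := h.continuous
  unfold exitLevel
  fun_prop

theorem exitLevel_le_one (h : IsGaugeAt P p g) {x : V × (Fin (k + 1) → ℝ)}
    (hx : x ∈ P ×ˢ stdSimplex ℝ (Fin (k + 1))) : exitLevel p g x ≤ 1 := by
  have h0 := hx.2.1 0
  have hl := hx.2.1 (Fin.last k)
  exact max_le ((h.mem_iff (subset_affineSpan ℝ P hx.1)).1 hx.1)
    (max_le (by linarith) (by linarith))

theorem exitLevel_eq_one (h : IsGaugeAt P p g) {x : V × (Fin (k + 1) → ℝ)}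
    (hx : x ∈ P ×ˢ stdSimplex ℝ (Fin (k + 1)))
    (hc : g (x.1 - p) = 1 ∨ x.2 0 = 0 ∨ x.2 (Fin.last k) = 0) : exitLevel p g x = 1 := by
  refine (exitLevel_le_one h hx).antisymm ?_
  rw [exitLevel, le_max_iff, le_max_iff]
  rcases hc with hc | hc | hc <;> simp [hc]

/-- An interior point can be moved away from any point of `X`. Moving away from `e_i` makes a zero
coordinate `i` negative; moving away from `(p, x.2)` raises a gauge equal to `1`. -/
theorem mem_intrinsicFrontier_of_exitLevel_eq_one (h : IsGaugeAt P p g)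
    {x : V × (Fin (k + 1) → ℝ)} (hx : x ∈ P ×ˢ stdSimplex ℝ (Fin (k + 1)))
    (hu : exitLevel p g x = 1) :
    x ∈ intrinsicFrontier ℝ (P ×ˢ stdSimplex ℝ (Fin (k + 1))) := by
  have hmem := subset_intrinsicClosure (𝕜 := ℝ) hx
  rw [← intrinsicInterior_union_intrinsicFrontier] at hmem
  refine hmem.resolve_left fun hint => ?_
  have hcoord : ∀ i, x.2 i ≠ 0 := by
    intro i hi
    obtain ⟨δ, hδ, hm⟩ := exists_pos_add_smul_sub_mem hint
      (show (x.1, Pi.single i 1) ∈ P ×ˢ stdSimplex ℝ (Fin (k + 1)) from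
        ⟨hx.1, single_mem_stdSimplex ℝ i⟩)
    have := hm.2.1 i
    simp [hi] at this
    linarith
  obtain hg | h0 | hl := eq_of_exitLevel_eq_one hu
  · obtain ⟨δ, hδ, hm⟩ := exists_pos_add_smul_sub_mem hint
      (show (p, x.2) ∈ P ×ˢ stdSimplex ℝ (Fin (k + 1)) from ⟨h.mem, hx.2⟩)
    have := (h.mem_iff (subset_affineSpan ℝ P hm.1)).1 hm.1
    have he : (x + δ • (x - (p, x.2))).1 - p = (1 + δ) • (x.1 - p) := by
      simp only [Prod.fst_add, Prod.smul_fst, Prod.fst_sub, add_smul, one_smul]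
      abel
    rw [he, h.smul _ (by positivity), hg] at this
    linarith
  · exact hcoord _ h0
  · exact hcoord _ hl

theorem mem_innerFacets_of_exitLevel_lt_one (h : IsGaugeAt P p g) (hcl : IsClosed P)
    {x : V × (Fin (k + 1) → ℝ)}
    (hx : x ∈ intrinsicFrontier ℝ (P ×ˢ stdSimplex ℝ (Fin (k + 1))))
    (hu : exitLevel p g x < 1) : x ∈ P ×ˢ innerFacets k := by
  have hxX := intrinsicFrontier_subset (hcl.prod (isClosed_stdSimplex _ _)) hx
  refine ⟨hxX.1, mem_innerFacets.2 ⟨hxX.2, ?_⟩⟩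
  by_contra! hcon
  simp only [exitLevel, max_lt_iff] at hu
  obtain ⟨hg, h0, hl⟩ := hu
  have hpos : ∀ i, 0 < x.2 i := by
    intro i
    by_cases hi0 : i = 0
    · subst hi0; linarith
    by_cases hil : i = Fin.last k
    · subst hil; linarith
    exact lt_of_le_of_ne (hxX.2.1 i) (hcon i ⟨hi0, hil⟩).symm
  let σ : (V × (Fin (k + 1) → ℝ)) →ₗ[ℝ] ℝ :=
    ∑ i, (LinearMap.proj i).comp (LinearMap.snd ℝ V (Fin (k + 1) → ℝ))
  have hσ : ∀ y, σ y = ∑ i, y.2 i := fun y => by simp [σ]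
  -- `S` is the affine span of `P` times the hyperplane of coordinate sum `1`. When no inner
  -- coordinate vanishes, all inequalities cutting `X` out of `S` are strict at `x`.
  let S : AffineSubspace ℝ (V × (Fin (k + 1) → ℝ)) :=
    (affineSpan ℝ P).comap (LinearMap.fst ℝ V (Fin (k + 1) → ℝ)).toAffineMap ⊓
      (AffineSubspace.mk' (1 : ℝ) ⊥).comap σ.toAffineMap
  have hS : ∀ y, y ∈ S ↔ y.1 ∈ affineSpan ℝ P ∧ ∑ i, y.2 i = 1 := by
    intro y
    simp only [S, AffineSubspace.mem_inf_iff, AffineSubspace.mem_comap, LinearMap.coe_toAffineMap,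
      AffineSubspace.mem_mk', hσ, LinearMap.fst_apply, Submodule.mem_bot, vsub_eq_sub,
      sub_eq_zero]
  refine notMem_intrinsicFrontier_of_isOpen S (U := {y | g (y.1 - p) < 1} ∩ ⋂ i, {y | 0 < y.2 i})
    ?_ ?_ ?_ ?_ hx
  · exact fun y hy => (hS y).2 ⟨subset_affineSpan ℝ P hy.1, hy.2.2⟩
  · have := h.continuous
    refine (isOpen_lt (by fun_prop) (by fun_prop)).inter (isOpen_iInter_of_finite fun i => ?_)
    exact isOpen_lt (by fun_prop) (by fun_prop)
  · exact ⟨hg, mem_iInter.2 hpos⟩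
  · rintro y ⟨⟨hy1, hy2⟩, hyS⟩
    have hyS := (hS y).1 hyS
    exact ⟨(h.mem_iff hyS.1).2 (le_of_lt hy1), fun i => (mem_iInter.1 hy2 i).le, hyS.2⟩

/-- Every point at exit level `1` is a limit of such points outside the inner facets. -/
theorem notMem_interiorIn_of_exitLevel_eq_one (h : IsGaugeAt P p g) (hk : k ≠ 0)
    {x : V × (Fin (k + 1) → ℝ)} (hx : x ∈ P ×ˢ stdSimplex ℝ (Fin (k + 1)))
    (hu : exitLevel p g x = 1) :
    x ∉ interiorIn (intrinsicFrontier ℝ (P ×ˢ stdSimplex ℝ (Fin (k + 1))))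
      (P ×ˢ innerFacets k) := by
  rintro ⟨⟨y, hyB⟩, hy, rfl⟩
  dsimp only at hx hu
  obtain ⟨j, hj, hyj⟩ : ∃ j : Fin (k + 1), (j = 0 ∨ j = Fin.last k) ∧
      (g (y.1 - p) = 1 ∨ y.2 j = 0) := by
    rcases eq_of_exitLevel_eq_one hu with hg | h0 | hl
    exacts [⟨0, .inl rfl, .inl hg⟩, ⟨0, .inl rfl, .inr h0⟩, ⟨_, .inr rfl, .inr hl⟩]
  have hk' : (0 : ℝ) < k := by positivity
  -- Barycentre of the facet opposite `e_j`. Moving `y.2` towards it keeps the gauge and a zero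
  -- coordinate `j`, hence stays on the frontier, but makes every inner coordinate positive, hence
  -- leaves `Y`.
  let w : Fin (k + 1) → ℝ := fun i => if i = j then 0 else (k : ℝ)⁻¹
  have hw : w ∈ stdSimplex ℝ (Fin (k + 1)) := by
    refine ⟨fun i => ?_, ?_⟩
    · simp only [w]; split_ifs <;> positivity
    · simp [w, Finset.sum_ite, Finset.filter_ne', hk'.ne']
  let f : ℝ → V × (Fin (k + 1) → ℝ) := fun ε => (y.1, AffineMap.lineMap y.2 w ε)
  let e : ℕ → ℝ := fun n => 1 / ((n : ℝ) + 1)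
  have he : ∀ n, 0 < e n ∧ e n ≤ 1 := fun n =>
    ⟨by positivity, (div_le_one (by positivity)).2 (by simp)⟩
  have hcoord : ∀ n i, (f (e n)).2 i = (1 - e n) * y.2 i + e n * w i := fun n i => by
    simp [f, AffineMap.lineMap_apply_module]
  have hfX : ∀ n, f (e n) ∈ P ×ˢ stdSimplex ℝ (Fin (k + 1)) := fun n =>
    ⟨hx.1, (convex_stdSimplex ℝ _).lineMap_mem hx.2 hw ⟨(he n).1.le, (he n).2⟩⟩
  have hfB : ∀ n, f (e n) ∈ intrinsicFrontier ℝ (P ×ˢ stdSimplex ℝ (Fin (k + 1))) := fun n => by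
    refine mem_intrinsicFrontier_of_exitLevel_eq_one h (hfX n) (exitLevel_eq_one h (hfX n) ?_)
    refine hyj.imp id fun hyj => ?_
    have : (f (e n)).2 j = 0 := by rw [hcoord, hyj]; simp [w]
    rcases hj with rfl | rfl
    exacts [.inl this, .inr this]
  have hlim : Filter.Tendsto (fun n => (⟨f (e n), hfB n⟩ : intrinsicFrontier ℝ _)) Filter.atTop
      (𝓝 ⟨y, hyB⟩) := by
    rw [tendsto_subtype_rng]
    have hf : Continuous f := by
      simp only [f, AffineMap.lineMap_apply_module]
      fun_prop
    have hf0 : f 0 = y := by simp [f]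
    have := (hf.tendsto 0).comp (tendsto_one_div_add_atTop_nhds_zero_nat (𝕜 := ℝ))
    rwa [hf0] at this
  obtain ⟨n, hn⟩ := (hlim.eventually (mem_interior_iff_mem_nhds.1 hy)).exists
  obtain ⟨i, ⟨hi0, hil⟩, hi⟩ := (mem_innerFacets.1 hn.2).2
  have hij : i ≠ j := by rcases hj with rfl | rfl <;> assumption
  have hwi : 0 < w i := by simp [w, hij, hk']
  have := mul_nonneg (sub_nonneg.2 (he n).2) (hx.2.1 i)
  have := mul_pos (he n).1 hwi
  have := hcoord n i
  dsimp only at hi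
  linarith

theorem frontier_diff_interiorIn_eq (h : IsGaugeAt P p g) (hcl : IsClosed P) (hk : k ≠ 0) :
    intrinsicFrontier ℝ (P ×ˢ stdSimplex ℝ (Fin (k + 1))) \
        interiorIn (intrinsicFrontier ℝ (P ×ˢ stdSimplex ℝ (Fin (k + 1)))) (P ×ˢ innerFacets k) =
      {x | x ∈ P ×ˢ stdSimplex ℝ (Fin (k + 1)) ∧ exitLevel p g x = 1} := by
  ext x
  constructor
  · rintro ⟨hx, hxi⟩
    have hxX := intrinsicFrontier_subset (hcl.prod (isClosed_stdSimplex _ _)) hx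
    refine ⟨hxX, (exitLevel_le_one h hxX).antisymm (not_lt.1 fun hlt => hxi ?_)⟩
    refine ⟨⟨x, hx⟩, mem_interior.2 ⟨Subtype.val ⁻¹' {y | exitLevel p g y < 1}, ?_, ?_, hlt⟩, rfl⟩
    · exact fun y hy => mem_innerFacets_of_exitLevel_lt_one h hcl y.2 hy
    · exact (isOpen_lt (continuous_exitLevel h) continuous_const).preimage continuous_subtype_val
  · rintro ⟨hx, hu⟩
    exact ⟨mem_intrinsicFrontier_of_exitLevel_eq_one h hx hu,
      notMem_interiorIn_of_exitLevel_eq_one h hk hx hu⟩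

/-! ### Radial projection and the retraction. -/

/-- The point of `ℝ^{k+1}` from which the simplex is projected. -/
def exitCentre (k : ℕ) : Fin (k + 1) → ℝ :=
  Pi.single 0 1 + Pi.single (Fin.last k) 1 - Pi.single 1 1

/-- The point where the ray from `(p, exitCentre k)` through `x` leaves `P × Δ^k`. -/
noncomputable def exitPoint (p : V) (g : V → ℝ) (x : V × (Fin (k + 1) → ℝ)) :
    V × (Fin (k + 1) → ℝ) :=
  (p, exitCentre k) + (exitLevel p g x)⁻¹ • (x - (p, exitCentre k))

theorem exitCentre_zero (hk : 2 ≤ k) : exitCentre k 0 = 1 := by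
  obtain ⟨k, rfl⟩ := Nat.exists_eq_add_of_le' hk
  simp [exitCentre, Fin.ext_iff]

theorem exitCentre_last (hk : 2 ≤ k) : exitCentre k (Fin.last k) = 1 := by
  obtain ⟨k, rfl⟩ := Nat.exists_eq_add_of_le' hk
  simp [exitCentre, Fin.ext_iff]

theorem exitCentre_nonpos {i : Fin (k + 1)} (h0 : i ≠ 0) (hl : i ≠ Fin.last k) :
    exitCentre k i ≤ 0 := by
  simp only [exitCentre, Pi.add_apply, Pi.sub_apply, Pi.single_apply, h0, hl, if_false]
  split_ifs <;> norm_num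

theorem sum_exitCentre : ∑ i, exitCentre k i = 1 := by
  simp [exitCentre, Finset.sum_add_distrib]

theorem exitPoint_mem (h : IsGaugeAt P p g) (hk : 2 ≤ k) {x : V × (Fin (k + 1) → ℝ)}
    (hx : x ∈ P ×ˢ stdSimplex ℝ (Fin (k + 1))) :
    exitPoint p g x ∈ P ×ˢ stdSimplex ℝ (Fin (k + 1)) ∧ exitLevel p g (exitPoint p g x) = 1 := by
  have hpos : 0 < exitLevel p g x := exitLevel_pos (by lia) hx.2
  have hle := exitLevel_le_one h hx
  have hlev : exitLevel p g (exitPoint p g x) = 1 := by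
    -- The centre has gauge `0` and coordinates `0` and `last` equal to `1`, so all three terms of
    -- the maximum scale by the same factor.
    have hg : g ((exitPoint p g x).1 - p) = (exitLevel p g x)⁻¹ * g (x.1 - p) := by
      rw [← h.smul _ (inv_nonneg.2 hpos.le)]
      simp [exitPoint]
    have h0 : 1 - (exitPoint p g x).2 0 = (exitLevel p g x)⁻¹ * (1 - x.2 0) := by
      simp [exitPoint, exitCentre_zero hk]
      ring
    have hl : 1 - (exitPoint p g x).2 (Fin.last k) =
        (exitLevel p g x)⁻¹ * (1 - x.2 (Fin.last k)) := by
      simp [exitPoint, exitCentre_last hk]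
      ring
    rw [exitLevel, hg, h0, hl, ← mul_max_of_nonneg _ _ (inv_nonneg.2 hpos.le),
      ← mul_max_of_nonneg _ _ (inv_nonneg.2 hpos.le)]
    exact inv_mul_cancel₀ hpos.ne'
  refine ⟨⟨?_, fun i => ?_, ?_⟩, hlev⟩
  · have hmem : (exitPoint p g x).1 = p + (exitLevel p g x)⁻¹ • (x.1 - p) := by simp [exitPoint]
    rw [hmem, h.le_one_iff _ (Submodule.smul_mem _ _
      (h.sub_mem_direction (subset_affineSpan ℝ P hx.1)))]
    have := (le_max_left _ _).trans hlev.le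
    rwa [hmem, add_sub_cancel_left] at this
  · by_cases hi0 : i = 0
    · subst hi0
      have := (le_max_left _ _).trans ((le_max_right _ _).trans hlev.le)
      linarith
    by_cases hil : i = Fin.last k
    · subst hil
      have := (le_max_right _ _).trans ((le_max_right _ _).trans hlev.le)
      linarith
    have hc := exitCentre_nonpos hi0 hil
    have hinv : 1 ≤ (exitLevel p g x)⁻¹ := (one_le_inv₀ hpos).2 hle
    have hxi := hx.2.1 i
    -- The factor is at least `1` and the centre's coordinate is nonpositive, so both summands are
    -- nonnegative.
    have : (exitPoint p g x).2 i =
        (exitLevel p g x)⁻¹ * x.2 i + ((exitLevel p g x)⁻¹ - 1) * -exitCentre k i := by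
      simp [exitPoint]
      ring
    rw [this]
    have := sub_nonneg.2 hinv
    have := neg_nonneg.2 hc
    positivity
  · simp [exitPoint, Finset.sum_add_distrib, ← Finset.mul_sum, sum_exitCentre, hx.2.2]

theorem exitPoint_eq_self {x : V × (Fin (k + 1) → ℝ)} (hu : exitLevel p g x = 1) :
    exitPoint p g x = x := by
  simp [exitPoint, hu]

theorem isDeformationRetract_prod_stdSimplex [FiniteDimensional ℝ V] (hP : Convex ℝ P)
    (hcl : IsClosed P) (hne : P.Nonempty) (hk : 2 ≤ k) :
    IsDeformationRetract
      (intrinsicFrontier ℝ (P ×ˢ stdSimplex ℝ (Fin (k + 1))) \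
        interiorIn (intrinsicFrontier ℝ (P ×ˢ stdSimplex ℝ (Fin (k + 1)))) (P ×ˢ innerFacets k))
      (P ×ˢ stdSimplex ℝ (Fin (k + 1))) := by
  obtain ⟨p, g, h⟩ := exists_isGaugeAt hP hcl hne
  rw [frontier_diff_interiorIn_eq h hcl (by lia)]
  have hX : Convex ℝ (P ×ˢ stdSimplex ℝ (Fin (k + 1))) := hP.prod (convex_stdSimplex ℝ _)
  refine ⟨fun x hx => hx.1, ⟨fun z => ⟨AffineMap.lineMap (z.1 : V × (Fin (k + 1) → ℝ))
    (exitPoint p g z.1) (z.2 : ℝ), hX.lineMap_mem z.1.2 (exitPoint_mem h hk z.1.2).1 z.2.2⟩, ?_⟩,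
    fun x => ?_, fun x => ?_, fun x t hx => ?_⟩
  · have hu : Continuous fun z : (P ×ˢ stdSimplex ℝ (Fin (k + 1)) : Set _) × unitInterval =>
        (exitLevel p g (z.1 : V × (Fin (k + 1) → ℝ)))⁻¹ :=
      ((continuous_exitLevel h).comp (by fun_prop)).inv₀ fun z =>
        (exitLevel_pos (by lia) z.1.2.2).ne'
    simp only [AffineMap.lineMap_apply_module, exitPoint]
    fun_prop
  · ext1; simp
  · simpa using exitPoint_mem h hk x.2
  · ext1; simp [exitPoint_eq_self hx.2]

end ExitLevel

theorem mainTheorem7 (n k : ℕ) (hn : 3 ≤ n) (hk : 2 ≤ k) (m : Fin k → ℕ)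
    (hm : ∀ l, 1 ≤ m l) (hsum : ∑ l, m l = n - 1) :
    IsDeformationRetract
      (polytopeBoundary (productCell m) \
        interiorIn (polytopeBoundary (productCell m)) (gluedPart m))
      (productCell m) :=
  isDeformationRetract_prod_stdSimplex
    (convex_pi fun _ _ => convex_convexHull ℝ _)
    (isClosed_set_pi fun l _ => (isCompact_permutohedron (m l)).isClosed)
    (univ_pi_nonempty_iff.2 fun l => permutohedron_nonempty (m l)) hk
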